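/- Let $\mathcal X$ be a finite set and $w:\mathcal X\times\mathcal X\to[0,\infty)$ transition rates of an irreducible continuous-time Markov process $X$ on $\mathcal X$, with generator $\mathcal L f(x)=\sum_{y}w(x,y)(f(y)-f(x))$, reversible with respect to a probability measure $\mu$ on $\mathcal X$: $\mu(x)w(x,y)=\mu(y)w(y,x)$ for all $x,y$. Write $P_\nu$ for the law of $X$ started from the distribution $\nu$ and $P_x$ for the law of $X$ started from $x$. For $q'>0$ let $K_{q'}(x,y)=P_x(X(T_{q'})=y)$, where $T_{q'}$ is an exponential random variable of parameter $q'$ independent of $X$. A spanning oriented forest is a set $\phi$ of oriented edges $(x,y)$ with $w(x,y)>0$, in which every vertex has at most one outgoing edge and which has no oriented cycle; its roots, forming the set $\rho(\phi)$, are the vertices without outgoing edge, and each of its trees is oriented towards its unique root. For $q>0$ let $\pi_q$ be the probability measure on spanning oriented forests with $\pi_q(\phi)$ proportional to $q^{|\rho(\phi)|}\prod_{e\in\phi}w(e)$, and let $\mathbb E_q$ denote the expectation with respect to $\pi_q$. Let $q,q'>0$ and let $\Phi$ have law $\pi_q$. For $x\in\mathcal X$ let $A(x)$ be the vertex set of the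 tree of $\Phi$ containing $x$. Put $\bar{\mathcal X}=\rho(\Phi)$ and, for $\bar x,\bar y\in\bar{\mathcal X}$ and $y\in\mathcal X$, $$\Lambda(\bar x,y)=\mu_{A(\bar x)}(y)=\mu(\{y\}\mid A(\bar x)),\qquad \bar P(\bar x,\bar y)=P_{\mu_{A(\bar x)}}\bigl(X(T_{q'})\in A(\bar y)\bigr).$$ Let $d_{TV}(\nu,\nu')=\frac12\sum_{x\in\mathcal X}|\nu(x)-\nu'(x)|$. Let $\Phi'$ be a forest of law $\pi_{q'}$, independent of $\Phi$ and $X$, and for $x\in\mathcal X$ let $|\Gamma'_x|$ be the number of edges of the path in $\Phi'$ from $x$ to the root of its tree. Then, for every $p\in[1,\infty]$ with conjugate exponent $p^*$ (that is, $\frac1p+\frac1{p^*}=1$, with $\frac1\infty=0$ and $t^0=1$ for every $t\ge 0$), $$\mathbb E_q\Bigl[\sum_{\bar x\in\bar{\mathcal X}}d_{TV}\bigl(\Lambda K_{q'}(\bar x,\cdot),\,\bar P\Lambda(\bar x,\cdot)\bigr)\Bigr]\le\Bigl(\mathbb E_q\bigl[|\rho(\Phi)|\bigr]\Bigr)^{1/p}\Bigl(\frac{q'}{q}\sum_{x\in\mathcal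 X}\mathbb E_{q'}\bigl[|\Gamma'_x|\bigr]\Bigr)^{1/p^*}.$$ -/

import Mathlib

open Finset

noncomputable section

namespace ForestIntertwining

variable {V : Type*} [Fintype V] [DecidableEq V]

/-! ### The Markov process on the finite state space `V` with transition rates `w` -/

/-- The generator as a matrix: `L x y = w x y` for `x ≠ y`, and `L x x = - ∑_{y ≠ x} w x y`. -/
def generator (w : V → V → ℝ) : Matrix V V ℝ :=
  fun x y => if x = y then - ∑ z ∈ univ.erase x, w x z else w x y

/-- The transition function of the continuous time process `X` with generator `L`:
`P_x (X(t) = y) = (exp (t L)) x y`. -/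
def transition (w : V → V → ℝ) (t : ℝ) : Matrix V V ℝ :=
  NormedSpace.exp (t • generator w)

/-- The kernel `K_q (x, y) = P_x (X(T_q) = y)`, where `T_q` is an exponential random variable of
parameter `q`, independent of `X`. -/
def expKernel (w : V → V → ℝ) (q : ℝ) : Matrix V V ℝ :=
  fun x y => ∫ t, transition w t x y ∂(ProbabilityTheory.expMeasure q)

/-- `P_ν (X(T_q) ∈ B)`: the process is started from the distribution `ν`. -/
def probExpTime (w : V → V → ℝ) (q : ℝ) (ν : V → ℝ) (B : Finset V) : ℝ :=
  ∑ x, ν x * ∑ y ∈ B, expKernel w q x y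

/-- The oriented graph defined by `w` is strongly connected. -/
def IsIrreducible (w : V → V → ℝ) : Prop :=
  ∀ x y, Relation.ReflTransGen (fun a b => 0 < w a b) x y

/-- `μ` is a probability measure on `V`. -/
def IsProbVector (μ : V → ℝ) : Prop :=
  (∀ x, 0 ≤ μ x) ∧ ∑ x, μ x = 1

/-- Reversibility (detailed balance). -/
def IsReversible (w : V → V → ℝ) (μ : V → ℝ) : Prop :=
  ∀ x y, μ x * w x y = μ y * w y x

/-- `μ` conditioned on `A`. -/
def condOn (μ : V → ℝ) (A : Finset V) : V → ℝ :=
  fun x => if x ∈ A then μ x / ∑ z ∈ A, μ z else 0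

/-- Total variation distance between two probability measures on `V`. -/
def dTV (ν ν' : V → ℝ) : ℝ :=
  (1 / 2) * ∑ x, |ν x - ν' x|

/-! ### Spanning oriented forests, given by their sets of oriented edges -/

/-- A spanning oriented forest of the oriented graph of `w`: every edge is an edge of this graph,
every vertex has at most one outgoing edge, and there is no oriented cycle.  The vertices
are all the points of `V`; each component is a tree whose edges point towards its unique vertex
without outgoing edge, the root. -/
def IsSpanningForest (w : V → V → ℝ) (φ : Finset (V × V)) : Prop :=
  (∀ e ∈ φ, 0 < w e.1 e.2) ∧
  (∀ x y z, (x, y) ∈ φ → (x, z) ∈ φ → y = z) ∧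
  (∀ x, ¬ Relation.TransGen (fun a b => (a, b) ∈ φ) x x)

open Classical in
/-- The finite set of all spanning oriented forests. -/
def spanningForests (w : V → V → ℝ) : Finset (Finset (V × V)) :=
  univ.filter fun φ => IsSpanningForest w φ

/-- `LeadsTo φ x y`: following the edges of `φ` from `x`, one visits `y` (`x` itself is
visited). -/
def LeadsTo (φ : Finset (V × V)) (x y : V) : Prop :=
  Relation.ReflTransGen (fun a b => (a, b) ∈ φ) x y

/-- The set of roots `ρ(φ)`. -/
def roots (φ : Finset (V × V)) : Finset V :=
  univ.filter fun x => ∀ y, (x, y) ∉ φ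

open Classical in
/-- The block `A(x)` of the partition of `V` induced by `φ`: the set of the vertices of the tree
of `φ` that contains `x`, i.e. of the vertices with the same root as `x`. -/
def treeBlock (φ : Finset (V × V)) (x : V) : Finset V :=
  univ.filter fun y => ∃ r ∈ roots φ, LeadsTo φ x r ∧ LeadsTo φ y r

open Classical in
/-- The edges of the path of `φ` from `x` to its root: since a vertex of a forest has at most one
outgoing edge, these are the edges of `φ` whose starting point is visited when following `φ`
from `x`. -/
def rootPath (φ : Finset (V × V)) (x : V) : Finset (V × V) :=
  φ.filter fun e => LeadsTo φ x e.1

/-- The weight `q ^ |ρ(φ)| * ∏_{e ∈ φ} w e`. -/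
def forestWeight (w : V → V → ℝ) (q : ℝ) (φ : Finset (V × V)) : ℝ :=
  q ^ (roots φ).card * ∏ e ∈ φ, w e.1 e.2

/-- The partition function `Z(q)`. -/
def partitionFunction (w : V → V → ℝ) (q : ℝ) : ℝ :=
  ∑ φ ∈ spanningForests w, forestWeight w q φ

/-- The probability `π_q (φ)` of a spanning oriented forest `φ`. -/
def forestProb (w : V → V → ℝ) (q : ℝ) (φ : Finset (V × V)) : ℝ :=
  forestWeight w q φ / partitionFunction w q

/-- The expectation `E_q [f(Φ)]` for a random spanning forest `Φ` of law `π_q`. -/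
def forestExp (w : V → V → ℝ) (q : ℝ) (f : Finset (V × V) → ℝ) : ℝ :=
  ∑ φ ∈ spanningForests w, forestProb w q φ * f φ

/-! ### The approximate solution of the intertwining equation attached to a forest -/

/-- The rectangular matrix `Λ(x, ·) = μ_{A(x)}`, `x ∈ ρ(φ)`. -/
def forestLambda (μ : V → ℝ) (φ : Finset (V × V)) : Matrix (roots φ) V ℝ :=
  fun x y => condOn μ (treeBlock φ x) y

/-- The square matrix `P̄(x, y) = P_{μ_{A(x)}} (X(T_{q'}) ∈ A(y))`, `x, y ∈ ρ(φ)`. -/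
def forestPbar (w : V → V → ℝ) (μ : V → ℝ) (q' : ℝ) (φ : Finset (V × V)) :
    Matrix (roots φ) (roots φ) ℝ :=
  fun x y => probExpTime w q' (condOn μ (treeBlock φ x)) (treeBlock φ y)

/-- The error in the intertwining equation: the sum over `x ∈ ρ(φ)` of the total variation
distances between `Λ K_{q'} (x, ·)` and `P̄ Λ (x, ·)`. -/
def intertwiningError (w : V → V → ℝ) (μ : V → ℝ) (q' : ℝ) (φ : Finset (V × V)) : ℝ :=
  ∑ x : roots φ,
    dTV ((forestLambda μ φ * expKernel w q') x) ((forestPbar w μ q' φ * forestLambda μ φ) x)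

end ForestIntertwining

end

set_option linter.unusedSectionVars false

/-!
Write `ρ_x` for the root of the tree of `x` in a forest `Φ` of law `π_q`, and `ρ'_x` for the root
in an independent forest `Φ'` of law `π_{q'}`. The expected error is at most `E_q |ρ(Φ)|`, because
total variation distances are at most one. If it is also at most `(q' / q) ∑ x, E_{q'} |Γ'_x|`, then
the general case follows from `e = e ^ (1 / p) * e ^ (1 / p*)`. The second bound rests on two weight
identities for forests.

* Removing an edge `(u, v)` is a bijection onto the forests in which `u` is a root and `v` lies in
  another tree, and it multiplies the weight by `q / w u v` (`forestExp_edge`).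
* By reversibility, moving the root of a tree from `y` to `z` multiplies the weight by `μ z / μ y`
  (`forestExp_reroot`). The forest with the new root is unique, since a forest is determined by its
  unoriented edges and its roots.

The first identity shows that the matrix `P(ρ'_x = y)` solves the resolvent equation
(`rootProb_resolvent`), so that it equals `K_{q'}` (`expKernel_eq_rootProb`). The error of a
fixed forest is thus expressed by the differences `μ z P(ρ'_x = y) - μ y P(ρ'_x = z)`, with `y` and
`z` in the same tree of `Φ`. By the second identity the event that `y` and `z` are in the same tree
of `Φ'` does not contribute (`mul_rootProb_sub`). Since the root of a tree given its vertices has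
the conditional law of `μ` (`forestExp_condOn`), the expected error is at most the expected number
of the points `x` for which the root in `Φ` of `y = ρ'_x` is not in the tree of `y` in `Φ'`.

For such an `x`, the path of `Φ` from `y` to its root has an edge `e = (u, v)` that leaves the tree
of `y` in `Φ'`. Move `e` from `Φ` to `Φ'`: in `Φ` remove it and move the root of the tree of `u`
from `u` to `y`, in `Φ'` move the root from `y` to `u` and add `e`. The weights of the pairs
change by the factor `q / q'`, the vertex `y` is recovered as the new root of `u` in `Φ`, and `e` is
an edge of the path from `x` in the new `Φ'` (`forestExp_edge_mul_le`). Summing over `y` and `e`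
leaves `(q' / q) E_{q'} |Γ'_x|`.
-/

namespace ForestIntertwining

noncomputable section

variable {V : Type*} [Fintype V] [DecidableEq V]

/-! ### Roots of forests -/

open Classical in
/-- The root of the tree of `φ` containing `x`; the junk value `x` is used when no root can be
reached from `x`, which never happens in a forest. -/
def root (φ : Finset (V × V)) (x : V) : V :=
  if h : ∃ r ∈ roots φ, LeadsTo φ x r then h.choose else x

theorem LeadsTo.mono {φ ψ : Finset (V × V)} (h : φ ⊆ ψ) {x y : V} (hxy : LeadsTo φ x y) :
    LeadsTo ψ x y :=
  Relation.ReflTransGen.mono (fun _ _ hab => h hab) _ _ hxy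

theorem mem_roots {φ : Finset (V × V)} {x : V} : x ∈ roots φ ↔ ∀ y, (x, y) ∉ φ := by
  simp [roots]

theorem mem_spanningForests {w : V → V → ℝ} {φ : Finset (V × V)} :
    φ ∈ spanningForests w ↔ IsSpanningForest w φ := by
  simp [spanningForests]

theorem roots_insert (φ : Finset (V × V)) (u v : V) :
    roots (insert (u, v) φ) = (roots φ).erase u := by
  ext x
  simp only [mem_roots, mem_erase, mem_insert, Prod.mk.injEq, not_or, not_and]
  constructor
  · intro h
    exact ⟨fun hx => (h v).1 hx rfl, fun y => (h y).2⟩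
  · exact fun h y => ⟨fun hx => absurd hx h.1, h.2 y⟩

theorem LeadsTo.eq_of_mem_roots {φ : Finset (V × V)} {r y : V} (hr : r ∈ roots φ)
    (h : LeadsTo φ r y) : y = r := by
  rcases Relation.ReflTransGen.cases_head h with h | ⟨c, hc, -⟩
  · exact h.symm
  · exact absurd hc (mem_roots.1 hr c)

namespace IsSpanningForest

variable {w : V → V → ℝ} {φ : Finset (V × V)}

theorem exists_root (hφ : IsSpanningForest w φ) (x : V) : ∃ r ∈ roots φ, LeadsTo φ x r := by
  let T : V → V → Prop := Relation.TransGen (fun a b => (b, a) ∈ φ)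
  have hirr : Std.Irrefl T := ⟨fun a h => hφ.2.2 a (by
    have := Relation.transGen_swap.1 h
    exact this)⟩
  have htr : IsTrans V T := ⟨fun _ _ _ => Relation.TransGen.trans⟩
  have hwf : WellFounded T := Finite.wellFounded_of_trans_of_irrefl T
  induction x using hwf.induction with
  | _ x ih =>
    by_cases hx : x ∈ roots φ
    · exact ⟨x, hx, Relation.ReflTransGen.refl⟩
    · simp only [mem_roots, not_forall, not_not] at hx
      obtain ⟨y, hy⟩ := hx
      obtain ⟨r, hr, hyr⟩ := ih y (Relation.TransGen.single hy)
      exact ⟨r, hr, Relation.ReflTransGen.head hy hyr⟩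

theorem root_mem (hφ : IsSpanningForest w φ) (x : V) : root φ x ∈ roots φ := by
  rw [root, dif_pos (hφ.exists_root x)]
  exact (hφ.exists_root x).choose_spec.1

theorem leadsTo_root (hφ : IsSpanningForest w φ) (x : V) : LeadsTo φ x (root φ x) := by
  rw [root, dif_pos (hφ.exists_root x)]
  exact (hφ.exists_root x).choose_spec.2

theorem eq_of_leadsTo (hφ : IsSpanningForest w φ) {x r s : V} (hr : r ∈ roots φ)
    (hs : s ∈ roots φ) (hxr : LeadsTo φ x r) (hxs : LeadsTo φ x s) : r = s := by
  rcases Relation.ReflTransGen.total_of_right_unique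
    (fun a b c hab hac => hφ.2.1 a b c hab hac) hxr hxs with h | h
  · exact (LeadsTo.eq_of_mem_roots hr h).symm
  · exact LeadsTo.eq_of_mem_roots hs h

theorem root_eq (hφ : IsSpanningForest w φ) {x r : V} (hr : r ∈ roots φ) (h : LeadsTo φ x r) :
    root φ x = r :=
  hφ.eq_of_leadsTo (hφ.root_mem x) hr (hφ.leadsTo_root x) h

theorem root_eq_iff (hφ : IsSpanningForest w φ) {x r : V} :
    root φ x = r ↔ r ∈ roots φ ∧ LeadsTo φ x r :=
  ⟨fun h => h ▸ ⟨hφ.root_mem x, hφ.leadsTo_root x⟩, fun h => hφ.root_eq h.1 h.2⟩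

theorem root_eq_self_iff (hφ : IsSpanningForest w φ) {x : V} : root φ x = x ↔ x ∈ roots φ :=
  ⟨fun h => (hφ.root_eq_iff.1 h).1, fun h => hφ.root_eq h Relation.ReflTransGen.refl⟩

theorem root_root (hφ : IsSpanningForest w φ) (x : V) : root φ (root φ x) = root φ x :=
  hφ.root_eq_self_iff.2 (hφ.root_mem x)

theorem root_eq_of_mem (hφ : IsSpanningForest w φ) {x y : V} (h : (x, y) ∈ φ) :
    root φ x = root φ y :=
  hφ.root_eq (hφ.root_mem y) (Relation.ReflTransGen.head h (hφ.leadsTo_root y))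

theorem mem_treeBlock (hφ : IsSpanningForest w φ) {x y : V} :
    y ∈ treeBlock φ x ↔ root φ y = root φ x := by
  simp only [treeBlock, mem_filter, mem_univ, true_and]
  constructor
  · rintro ⟨r, hr, h1, h2⟩
    rw [hφ.root_eq hr h1, hφ.root_eq hr h2]
  · intro h
    exact ⟨root φ x, hφ.root_mem x, hφ.leadsTo_root x, h ▸ hφ.leadsTo_root y⟩

/-- If `g` holds at `y` but not at the root of `y`, then some edge on the path from `y` to its
root leaves the set where `g` holds. -/
theorem exists_exit_edge (hφ : IsSpanningForest w φ) (g : V → Prop) {y : V} (hy : g y)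
    (hr : ¬ g (root φ y)) : ∃ u v, (u, v) ∈ φ ∧ LeadsTo φ y u ∧ g u ∧ ¬ g v := by
  by_contra! hcon
  have key : ∀ z, LeadsTo φ y z → g z := by
    intro z hz
    induction hz with
    | refl => exact hy
    | tail hab hbc ih => exact hcon _ _ hbc hab ih
  exact hr (key _ (hφ.leadsTo_root y))

/-! ### Adding and removing an edge -/

theorem erase_edge (hφ : IsSpanningForest w φ) (e : V × V) : IsSpanningForest w (φ.erase e) := by
  refine ⟨fun a ha => hφ.1 a (mem_of_mem_erase ha), fun x y z hy hz =>
    hφ.2.1 x y z (mem_of_mem_erase hy) (mem_of_mem_erase hz), fun x hx => hφ.2.2 x ?_⟩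
  exact Relation.TransGen.mono (fun _ _ h => mem_of_mem_erase h) _ _ hx

theorem mem_roots_erase (hφ : IsSpanningForest w φ) {u v : V} (h : (u, v) ∈ φ) :
    u ∈ roots (φ.erase (u, v)) := by
  rw [mem_roots]
  intro y hy
  have := hφ.2.1 u y v (mem_of_mem_erase hy) h
  subst this
  simp at hy

theorem root_erase_ne (hφ : IsSpanningForest w φ) {u v : V} (h : (u, v) ∈ φ) :
    root (φ.erase (u, v)) v ≠ u := by
  intro hr
  have h1 := ((hφ.erase_edge (u, v)).root_eq_iff.1 hr).2
  exact hφ.2.2 u (Relation.TransGen.head' h (h1.mono (erase_subset _ _)))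

theorem insert_edge (hφ : IsSpanningForest w φ) {u v : V} (hw : 0 < w u v) (hu : u ∈ roots φ)
    (hv : root φ v ≠ u) : IsSpanningForest w (insert (u, v) φ) := by
  have hu' := mem_roots.1 hu
  refine ⟨?_, ?_, ?_⟩
  · intro e he
    rcases mem_insert.1 he with rfl | he
    · exact hw
    · exact hφ.1 e he
  · intro x y z hy hz
    simp only [mem_insert, Prod.mk.injEq] at hy hz
    rcases hy with ⟨rfl, rfl⟩ | hy <;> rcases hz with ⟨h1, rfl⟩ | hz
    · rfl
    · exact absurd hz (hu' z)
    · exact absurd (h1 ▸ hy) (hu' y)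
    · exact hφ.2.1 x y z hy hz
  · -- the set of the vertices whose root is not `u` is stable and contains `v`, so that a cycle
    -- cannot use the edge `(u, v)`
    have step : ∀ a b, (a, b) ∈ insert (u, v) φ → root φ a ≠ u →
        (a, b) ∈ φ ∧ root φ b ≠ u := by
      intro a b hab ha
      rcases mem_insert.1 hab with h | h
      · simp only [Prod.mk.injEq] at h
        rw [h.1] at ha
        exact absurd (hφ.root_eq_self_iff.2 hu) ha
      · exact ⟨h, hφ.root_eq_of_mem h ▸ ha⟩
    have far : ∀ a b, Relation.TransGen (fun a b => (a, b) ∈ insert (u, v) φ) a b →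
        root φ a ≠ u → Relation.TransGen (fun a b => (a, b) ∈ φ) a b ∧ root φ b ≠ u := by
      intro a b hab ha
      induction hab with
      | single h => exact ⟨.single (step _ _ h ha).1, (step _ _ h ha).2⟩
      | tail _ h ih => exact ⟨ih.1.tail (step _ _ h ih.2).1, (step _ _ h ih.2).2⟩
    have near : ∀ a b, Relation.TransGen (fun a b => (a, b) ∈ insert (u, v) φ) a b →
        Relation.TransGen (fun a b => (a, b) ∈ φ) a b ∨ root φ b ≠ u := by
      intro a b hab
      induction hab with
      | single h =>
        rcases mem_insert.1 h with h | h
        · simp only [Prod.mk.injEq] at h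
          exact .inr (h.2 ▸ hv)
        · exact .inl (.single h)
      | tail _ h ih =>
        rcases mem_insert.1 h with h' | h'
        · simp only [Prod.mk.injEq] at h'
          exact .inr (h'.2 ▸ hv)
        · rcases ih with ih | ih
          · exact .inl (ih.tail h')
          · exact .inr (step _ _ h ih).2
    intro x hx
    rcases near x x hx with h | h
    · exact hφ.2.2 x h
    · exact hφ.2.2 x (far x x hx h).1

theorem root_insert (hφ : IsSpanningForest w φ) {u v : V} (hw : 0 < w u v) (hu : u ∈ roots φ)
    (hv : root φ v ≠ u) (x : V) :
    root (insert (u, v) φ) x = if root φ x = u then root φ v else root φ x := by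
  have hψ := hφ.insert_edge hw hu hv
  have hsub : φ ⊆ insert (u, v) φ := subset_insert _ _
  split_ifs with h
  · refine hψ.root_eq ?_ ?_
    · rw [roots_insert]; exact mem_erase.2 ⟨hv, hφ.root_mem v⟩
    · have h1 : LeadsTo φ x u := (hφ.root_eq_iff.1 h).2
      exact (h1.mono hsub).trans (Relation.ReflTransGen.head (mem_insert_self _ _)
        ((hφ.leadsTo_root v).mono hsub))
  · refine hψ.root_eq ?_ ((hφ.leadsTo_root x).mono hsub)
    rw [roots_insert]; exact mem_erase.2 ⟨h, hφ.root_mem x⟩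

/-- The new edge starts at `u`, so that it is not used before `u` is reached. -/
theorem leadsTo_insert_iff (hφ : IsSpanningForest w φ) {u v : V} (hu : u ∈ roots φ) (x : V) :
    LeadsTo (insert (u, v) φ) x u ↔ root φ x = u := by
  constructor
  · intro h
    induction h using Relation.ReflTransGen.head_induction_on with
    | refl => exact hφ.root_eq_self_iff.2 hu
    | head hab _ ih =>
      rcases mem_insert.1 hab with h | h
      · simp only [Prod.mk.injEq] at h
        rw [h.1]; exact hφ.root_eq_self_iff.2 hu
      · rw [hφ.root_eq_of_mem h]; exact ih
  · intro h
    exact (hφ.root_eq_iff.1 h).2.mono (subset_insert _ _)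

end IsSpanningForest

/-- Adding an edge going out of a root trades a factor `q` for the weight of the edge. -/
theorem forestWeight_insert (w : V → V → ℝ) (q : ℝ) {φ : Finset (V × V)} {u v : V}
    (hu : u ∈ roots φ) :
    q * forestWeight w q (insert (u, v) φ) = w u v * forestWeight w q φ := by
  unfold forestWeight
  rw [roots_insert, prod_insert (mem_roots.1 hu v),
    ← card_erase_add_one hu, pow_succ]
  ring

/-! ### Moving the root of a tree -/

/-- `φ'` has the same unoriented edges as `φ` (hence the same trees), and the same roots, but for
the tree of `z`, which is rooted at `z` in `φ'`. -/
structure IsRerooting (φ : Finset (V × V)) (z : V) (φ' : Finset (V × V)) : Prop where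
  edges : ∀ a b, ((a, b) ∈ φ' ∨ (b, a) ∈ φ') ↔ ((a, b) ∈ φ ∨ (b, a) ∈ φ)
  root_eq : ∀ a, root φ' a = if root φ a = root φ z then z else root φ a

/-- With its converse, this says that a forest is determined by its unoriented edges and its roots.
The edges of a path to a root are oriented in the same way in both forests, as one sees by going
backwards from the root. -/
theorem IsSpanningForest.subset_of_edges {w : V → V → ℝ} {φ φ' : Finset (V × V)}
    (hφ : IsSpanningForest w φ) (hφ' : IsSpanningForest w φ')
    (hedges : ∀ a b, ((a, b) ∈ φ' ∨ (b, a) ∈ φ') ↔ ((a, b) ∈ φ ∨ (b, a) ∈ φ))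
    (hroots : ∀ a, a ∈ roots φ → a ∈ roots φ') : φ ⊆ φ' := by
  have key : ∀ a r, r ∈ roots φ → LeadsTo φ a r → ∀ b, (a, b) ∈ φ → (a, b) ∈ φ' := by
    intro a r hr har
    induction har using Relation.ReflTransGen.head_induction_on with
    | refl => exact fun b hb => absurd hb (mem_roots.1 hr b)
    | @head a c hac hcr ih =>
      intro b hb
      obtain rfl : b = c := hφ.2.1 _ _ _ hb hac
      rcases (hedges a b).2 (.inl hb) with h | h
      · exact h
      · by_cases hbr : b ∈ roots φ
        · exact absurd h (mem_roots.1 (hroots b hbr) a)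
        · simp only [mem_roots, not_forall, not_not] at hbr
          obtain ⟨d, hd⟩ := hbr
          obtain rfl : a = d := hφ'.2.1 _ _ _ h (ih d hd)
          exact absurd (Relation.TransGen.tail (.single hb) hd) (hφ.2.2 a)
  rintro ⟨a, b⟩ hab
  exact key a _ (hφ.root_mem a) (hφ.leadsTo_root a) b hab

theorem IsRerooting.same_tree {w : V → V → ℝ} {φ φ' : Finset (V × V)} {z : V}
    (hφ : IsSpanningForest w φ) (h : IsRerooting φ z φ') (a b : V) :
    root φ' a = root φ' b ↔ root φ a = root φ b := by
  rw [h.root_eq, h.root_eq]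
  have aux : ∀ c, root φ c = z → root φ c = root φ z := by
    rintro c rfl; exact (hφ.root_root c).symm
  split_ifs with h1 h2 h2
  · simp [h1, h2]
  · exact ⟨fun h => absurd (aux b h.symm) h2, fun h => absurd (h ▸ h1) h2⟩
  · exact ⟨fun h => absurd (aux a h) h1, fun h => absurd (h ▸ h2) h1⟩
  · rfl

/-- Moving the root back restores the forest. -/
theorem IsRerooting.symm_eq {w : V → V → ℝ} {φ φ' φ'' : Finset (V × V)} {y z : V}
    (hφ : IsSpanningForest w φ) (hφ'' : IsSpanningForest w φ'')
    (hz : root φ z = y) (h : IsRerooting φ z φ') (h' : IsRerooting φ' y φ'') : φ'' = φ := by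
  have hedges : ∀ a b, ((a, b) ∈ φ'' ∨ (b, a) ∈ φ'') ↔ ((a, b) ∈ φ ∨ (b, a) ∈ φ) :=
    fun a b => (h'.edges a b).trans (h.edges a b)
  have hroot : ∀ a, root φ'' a = root φ a := by
    intro a
    rw [h'.root_eq]
    split_ifs with h1
    · rw [h.same_tree hφ, ← hz, hφ.root_root] at h1
      rw [h1, hz]
    · rw [h.root_eq, if_neg]
      rw [h.same_tree hφ, ← hz, hφ.root_root] at h1
      exact h1
  have hroots : ∀ a, a ∈ roots φ ↔ a ∈ roots φ'' := fun a => by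
    rw [← hφ.root_eq_self_iff, ← hφ''.root_eq_self_iff, hroot]
  exact (hφ''.subset_of_edges hφ (fun a b => (hedges a b).symm) fun a => (hroots a).2).antisymm
    (hφ.subset_of_edges hφ'' hedges fun a => (hroots a).1)

/-- Moving the root of a tree along one edge. -/
theorem IsSpanningForest.flip {w : V → V → ℝ} {q : ℝ} {φ : Finset (V × V)}
    (hq : q ≠ 0) (hφ : IsSpanningForest w φ) {z r : V} (hzr : (z, r) ∈ φ) (hr : r ∈ roots φ)
    (hw : 0 < w r z) :
    ∃ φ', IsSpanningForest w φ' ∧ IsRerooting φ z φ' ∧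
      w z r * forestWeight w q φ' = w r z * forestWeight w q φ := by
  set ψ := φ.erase (z, r) with hψdef
  have hψ : IsSpanningForest w ψ := hφ.erase_edge _
  have hφψ : insert (z, r) ψ = φ := insert_erase hzr
  have hzψ : z ∈ roots ψ := hφ.mem_roots_erase hzr
  have hne : root ψ r ≠ z := hφ.root_erase_ne hzr
  have hrψ : r ∈ roots ψ := mem_roots.2 fun y hy => mem_roots.1 hr y (mem_of_mem_erase hy)
  have hrr : root ψ r = r := hψ.root_eq_self_iff.2 hrψ
  have hzz : root ψ z = z := hψ.root_eq_self_iff.2 hzψ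
  have hwzr : 0 < w z r := hφ.1 _ hzr
  have hrz : r ≠ z := fun h => hne (hrr.trans h)
  have hne' : root ψ z ≠ r := by rw [hzz]; exact hrz.symm
  refine ⟨insert (r, z) ψ, hψ.insert_edge hw hrψ hne', ⟨?_, ?_⟩, ?_⟩
  · intro a b
    rw [← hφψ]
    simp only [mem_insert, Prod.mk.injEq]
    tauto
  · intro a
    rw [hψ.root_insert hw hrψ hne', ← hφψ, hψ.root_insert hwzr hzψ hne,
      hψ.root_insert hwzr hzψ hne, hrr, hzz, if_pos rfl]
    split_ifs <;> simp_all
  · have h1 := forestWeight_insert w q (v := z) hrψ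
    have h2 := forestWeight_insert w q (v := r) hzψ
    rw [hφψ] at h2
    apply mul_left_cancel₀ hq
    linear_combination w z r * h1 - w r z * h2

/-- In a tree with reversible weights, moving the root from `root φ z` to `z` multiplies the
weight by `μ z / μ (root φ z)`. -/
theorem IsSpanningForest.exists_rerooting {w : V → V → ℝ} {μ : V → ℝ} {q : ℝ}
    {φ : Finset (V × V)} (hq : q ≠ 0) (hμ : ∀ x, 0 < μ x) (hrev : IsReversible w μ)
    (hφ : IsSpanningForest w φ) (z : V) :
    ∃ φ', IsSpanningForest w φ' ∧ IsRerooting φ z φ' ∧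
      μ (root φ z) * forestWeight w q φ' = μ z * forestWeight w q φ := by
  have hz := hφ.leadsTo_root z
  have hr := hφ.root_mem z
  generalize root φ z = r at hz hr ⊢
  induction hz using Relation.ReflTransGen.head_induction_on with
  | refl =>
    refine ⟨φ, hφ, ⟨fun _ _ => Iff.rfl, fun a => ?_⟩, rfl⟩
    rw [hφ.root_eq_self_iff.2 hr]
    split_ifs with h <;> simp [h]
  | @head z y hzy _ ih =>
    obtain ⟨φ₁, hφ₁, h₁, hw₁⟩ := ih
    have hy : root φ₁ y = y := by rw [h₁.root_eq, if_pos rfl]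
    have hyr : y ∈ roots φ₁ := hφ₁.root_eq_self_iff.1 hy
    have hzy₁ : (z, y) ∈ φ₁ := by
      rcases (h₁.edges z y).2 (.inl hzy) with h | h
      · exact h
      · exact absurd h (mem_roots.1 hyr z)
    have hwzy : 0 < w z y := hφ.1 _ hzy
    have hwyz : 0 < w y z := by
      have := mul_pos (hμ z) hwzy
      rw [hrev z y] at this
      exact (pos_iff_pos_of_mul_pos this).1 (hμ y)
    obtain ⟨φ₂, hφ₂, h₂, hw₂⟩ := hφ₁.flip hq hzy₁ hyr hwyz
    refine ⟨φ₂, hφ₂, ⟨fun a b => (h₂.edges a b).trans (h₁.edges a b), fun a => ?_⟩, ?_⟩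
    · rw [h₂.root_eq]
      split_ifs with h h' h'
      · rfl
      · exact absurd ((h₁.same_tree hφ a z).1 h) h'
      · exact absurd ((h₁.same_tree hφ a z).2 h') h
      · rw [h₁.root_eq, if_neg]
        rwa [← hφ.root_eq_of_mem hzy]
    · apply mul_left_cancel₀ hwyz.ne'
      apply mul_left_cancel₀ (hμ y).ne'
      linear_combination (-μ r * forestWeight w q φ₂) * hrev z y + μ z * μ r * hw₂ +
        μ z * w y z * hw₁

/-! ### Expectations over random forests -/

section Expectation

variable {w : V → V → ℝ} {q : ℝ}

theorem forestWeight_pos (hq : 0 < q) {φ : Finset (V × V)} (hφ : IsSpanningForest w φ) :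
    0 < forestWeight w q φ :=
  mul_pos (pow_pos hq _) (prod_pos fun e he => hφ.1 e he)

theorem isSpanningForest_empty (w : V → V → ℝ) : IsSpanningForest w ∅ := by
  refine ⟨by simp, by simp, fun x hx => ?_⟩
  obtain ⟨y, -, hy⟩ := Relation.TransGen.tail'_iff.1 hx
  simp at hy

theorem partitionFunction_pos (w : V → V → ℝ) (hq : 0 < q) : 0 < partitionFunction w q :=
  sum_pos (fun _ hφ => forestWeight_pos hq (mem_spanningForests.1 hφ))
    ⟨∅, mem_spanningForests.2 (isSpanningForest_empty w)⟩

theorem forestProb_nonneg (hq : 0 < q) {φ : Finset (V × V)} (hφ : φ ∈ spanningForests w) :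
    0 ≤ forestProb w q φ :=
  div_nonneg (forestWeight_pos hq (mem_spanningForests.1 hφ)).le (partitionFunction_pos w hq).le

theorem sum_forestProb (w : V → V → ℝ) (hq : 0 < q) :
    ∑ φ ∈ spanningForests w, forestProb w q φ = 1 := by
  unfold forestProb
  rw [← sum_div]
  exact div_self (partitionFunction_pos w hq).ne'

theorem forestExp_const (w : V → V → ℝ) (hq : 0 < q) (c : ℝ) :
    forestExp w q (fun _ => c) = c := by
  rw [forestExp, ← sum_mul, sum_forestProb w hq, one_mul]

theorem forestExp_congr {f g : Finset (V × V) → ℝ}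
    (h : ∀ φ, IsSpanningForest w φ → f φ = g φ) : forestExp w q f = forestExp w q g :=
  sum_congr rfl fun φ hφ => by rw [h φ (mem_spanningForests.1 hφ)]

theorem forestExp_mono (hq : 0 < q) {f g : Finset (V × V) → ℝ}
    (h : ∀ φ, IsSpanningForest w φ → f φ ≤ g φ) : forestExp w q f ≤ forestExp w q g :=
  sum_le_sum fun φ hφ =>
    mul_le_mul_of_nonneg_left (h φ (mem_spanningForests.1 hφ)) (forestProb_nonneg hq hφ)

theorem forestExp_nonneg (hq : 0 < q) {f : Finset (V × V) → ℝ}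
    (h : ∀ φ, IsSpanningForest w φ → 0 ≤ f φ) : 0 ≤ forestExp w q f :=
  sum_nonneg fun φ hφ =>
    mul_nonneg (forestProb_nonneg hq hφ) (h φ (mem_spanningForests.1 hφ))

theorem forestExp_add (w : V → V → ℝ) (q : ℝ) (f g : Finset (V × V) → ℝ) :
    forestExp w q (fun φ => f φ + g φ) = forestExp w q f + forestExp w q g := by
  simp only [forestExp, mul_add, sum_add_distrib]

theorem forestExp_sub (w : V → V → ℝ) (q : ℝ) (f g : Finset (V × V) → ℝ) :
    forestExp w q (fun φ => f φ - g φ) = forestExp w q f - forestExp w q g := by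
  simp only [forestExp, mul_sub, sum_sub_distrib]

theorem forestExp_const_mul (w : V → V → ℝ) (q c : ℝ) (f : Finset (V × V) → ℝ) :
    forestExp w q (fun φ => c * f φ) = c * forestExp w q f := by
  simp only [forestExp, mul_sum]
  exact sum_congr rfl fun _ _ => by ring

theorem forestExp_mul_const (w : V → V → ℝ) (q c : ℝ) (f : Finset (V × V) → ℝ) :
    forestExp w q (fun φ => f φ * c) = forestExp w q f * c := by
  simp only [forestExp, sum_mul, mul_assoc]

theorem forestExp_sum {ι : Type*} (w : V → V → ℝ) (q : ℝ) (s : Finset ι)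
    (f : ι → Finset (V × V) → ℝ) :
    forestExp w q (fun φ => ∑ i ∈ s, f i φ) = ∑ i ∈ s, forestExp w q (f i) := by
  simp only [forestExp, mul_sum]
  exact sum_comm

theorem forestExp_eq_div (w : V → V → ℝ) (q : ℝ) (f : Finset (V × V) → ℝ) :
    forestExp w q f =
      (∑ φ ∈ spanningForests w, forestWeight w q φ * f φ) / partitionFunction w q := by
  rw [forestExp, sum_div]
  exact sum_congr rfl fun φ _ => by rw [forestProb]; ring

/-- The forests containing the edge `(u, v)` correspond to the forests in which `u` is a root and
`v` is in another tree. -/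
theorem forestExp_edge (hw : ∀ x y, 0 ≤ w x y) (u v : V) (g : Finset (V × V) → ℝ) :
    q * forestExp w q (fun φ => if (u, v) ∈ φ then g φ else 0) =
      w u v * forestExp w q
        (fun φ => if u ∈ roots φ ∧ root φ v ≠ u then g (insert (u, v) φ) else 0) := by
  rw [forestExp_eq_div, forestExp_eq_div, mul_div_assoc', mul_div_assoc']
  congr 1
  simp only [mul_ite, mul_zero, ← sum_filter]
  rw [mul_sum, mul_sum]
  rcases (hw u v).eq_or_lt with h0 | hpos
  · -- an edge of rate zero belongs to no forest, and both sides vanish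
    rw [← h0, filter_eq_empty_iff.2]
    · simp
    · intro φ hφ huv
      exact absurd ((mem_spanningForests.1 hφ).1 _ huv) (by simp [← h0])
  · refine sum_nbij' (fun φ => φ.erase (u, v)) (fun φ => insert (u, v) φ) ?_ ?_ ?_ ?_ ?_
    · intro φ h
      obtain ⟨hφ, huv⟩ := mem_filter.1 h
      have hφ := mem_spanningForests.1 hφ
      exact mem_filter.2 ⟨mem_spanningForests.2 (hφ.erase_edge _), hφ.mem_roots_erase huv,
        hφ.root_erase_ne huv⟩
    · intro φ h
      obtain ⟨hφ, hu, hv⟩ := mem_filter.1 h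
      have hφ := mem_spanningForests.1 hφ
      exact mem_filter.2 ⟨mem_spanningForests.2 (hφ.insert_edge hpos hu hv), mem_insert_self _ _⟩
    · intro φ h
      exact insert_erase (mem_filter.1 h).2
    · intro φ h
      exact erase_insert (mem_roots.1 (mem_filter.1 h).2.1 v)
    · intro φ h
      obtain ⟨hφ, huv⟩ := mem_filter.1 h
      have hφ := mem_spanningForests.1 hφ
      have := forestWeight_insert w q (v := v) (hφ.mem_roots_erase huv)
      rw [insert_erase huv] at this ⊢
      linear_combination g φ * this

/-- Resampling the edge going out of `x`. -/
theorem forestExp_resample (hw : ∀ x y, 0 ≤ w x y) (x : V) (g : Finset (V × V) → ℝ) :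
    q * forestExp w q g = forestExp w q (fun φ => if x ∈ roots φ then
      q * g φ + ∑ v, w x v * (if root φ v ≠ x then g (insert (x, v) φ) else 0) else 0) := by
  have h1 : forestExp w q g = forestExp w q (fun φ => if x ∈ roots φ then g φ else 0) +
      ∑ v, forestExp w q (fun φ => if (x, v) ∈ φ then g φ else 0) := by
    rw [← forestExp_sum, ← forestExp_add]
    refine forestExp_congr fun φ hφ => ?_
    by_cases hx : x ∈ roots φ
    · simp [hx, mem_roots.1 hx]
    · have hx' := hx
      simp only [mem_roots, not_forall, not_not] at hx'
      obtain ⟨y, hy⟩ := hx'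
      rw [if_neg hx, zero_add, sum_eq_single y, if_pos hy]
      · intro b _ hb
        exact if_neg fun h => hb (hφ.2.1 _ _ _ h hy)
      · simp
  rw [h1, mul_add, mul_sum]
  simp only [forestExp_edge hw, ← forestExp_const_mul, ← forestExp_sum, ← forestExp_add]
  refine forestExp_congr fun φ hφ => ?_
  by_cases hx : x ∈ roots φ <;> simp [hx]

/-- The root of a tree, given the trees, is distributed according to `μ`. -/
theorem forestExp_reroot {μ : V → ℝ} (hq : 0 < q) (hμ : ∀ x, 0 < μ x) (hrev : IsReversible w μ)
    (y z : V) (g : Finset (V × V) → ℝ)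
    (hg : ∀ φ φ', IsSpanningForest w φ → IsSpanningForest w φ' →
      (∀ a b, root φ' a = root φ' b ↔ root φ a = root φ b) → g φ' = g φ) :
    μ z * forestExp w q (fun φ => if root φ z = y then g φ else 0) =
      μ y * forestExp w q (fun φ => if root φ y = z then g φ else 0) := by
  rw [forestExp_eq_div, forestExp_eq_div, mul_div_assoc', mul_div_assoc']
  congr 1
  simp only [mul_ite, mul_zero, ← sum_filter]
  rw [mul_sum, mul_sum]
  have hex : ∀ (φ : Finset (V × V)) (x : V), ∃ φ', IsSpanningForest w φ →
      IsSpanningForest w φ' ∧ IsRerooting φ x φ' ∧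
      μ (root φ x) * forestWeight w q φ' = μ x * forestWeight w q φ := by
    intro φ x
    by_cases hφ : IsSpanningForest w φ
    · obtain ⟨φ', h⟩ := hφ.exists_rerooting hq.ne' hμ hrev x
      exact ⟨φ', fun _ => h⟩
    · exact ⟨φ, fun h => absurd h hφ⟩
  choose R hR using hex
  have hmem : ∀ y z, ∀ φ ∈ (spanningForests w).filter (fun φ => root φ z = y),
      R φ z ∈ (spanningForests w).filter (fun φ => root φ y = z) := by
    intro y z φ h
    obtain ⟨hφ, hz⟩ := mem_filter.1 h
    have hφ := mem_spanningForests.1 hφ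
    obtain ⟨h1, h2, -⟩ := hR φ z hφ
    refine mem_filter.2 ⟨mem_spanningForests.2 h1, ?_⟩
    rw [h2.root_eq, if_pos]
    rw [← hz, hφ.root_root]
  have hinv : ∀ y z, ∀ φ ∈ (spanningForests w).filter (fun φ => root φ z = y),
      R (R φ z) y = φ := by
    intro y z φ h
    obtain ⟨hφ, hz⟩ := mem_filter.1 h
    have hφ := mem_spanningForests.1 hφ
    obtain ⟨h1, h2, -⟩ := hR φ z hφ
    obtain ⟨h3, h4, -⟩ := hR (R φ z) y h1
    exact h2.symm_eq hφ h3 hz h4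
  refine sum_nbij' (fun φ => R φ z) (fun φ => R φ y) (hmem y z) (hmem z y) (hinv y z)
    (hinv z y) ?_
  intro φ h
  obtain ⟨hφ, hz⟩ := mem_filter.1 h
  have hφ := mem_spanningForests.1 hφ
  obtain ⟨h1, h2, h3⟩ := hR φ z hφ
  rw [hg φ (R φ z) hφ h1 (h2.same_tree hφ), ← hz]
  linear_combination (-g φ) * h3

/-- The probability that `y` is the root of the tree of `x`. -/
def rootProb (w : V → V → ℝ) (q : ℝ) (x y : V) : ℝ :=
  forestExp w q fun φ => if root φ x = y then 1 else 0

theorem rootProb_nonneg (hq : 0 < q) (x y : V) : 0 ≤ rootProb w q x y :=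
  forestExp_nonneg hq fun φ _ => by split_ifs <;> simp

theorem sum_rootProb (w : V → V → ℝ) (hq : 0 < q) (x : V) : ∑ y, rootProb w q x y = 1 := by
  simp [rootProb, ← forestExp_sum, forestExp_const w hq]

/-- The resolvent equation `(q - L) M = q` for the matrix `M` of the probabilities that `y` is the
root of the tree of `x`. -/
theorem rootProb_resolvent (hw : ∀ x y, 0 ≤ w x y) (hq : 0 < q) (x y : V) :
    q * rootProb w q x y + ∑ v, w x v * (rootProb w q x y - rootProb w q v y) =
      if x = y then q else 0 := by
  let b : Finset (V × V) → V → ℝ := fun φ v => if root φ v = y then 1 else 0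
  let i : ℝ := if x = y then 1 else 0
  have h0 : forestExp w q (fun φ => q * b φ x + ∑ v, w x v * (b φ x - b φ v) - q * i) = 0 := by
    refine (mul_eq_zero.1 ?_).resolve_left hq.ne'
    rw [forestExp_resample hw x]
    refine Eq.trans (forestExp_congr fun φ hφ => ?_) (forestExp_const w hq 0)
    split_ifs with hx
    swap; · rfl
    -- `φ` is fixed with root `x`; only the edges from `x` to the other trees can be added, and
    -- `c` is their rate
    have hxx : root φ x = x := hφ.root_eq_self_iff.2 hx
    have hbx : b φ x = i := by simp only [b, i, hxx]
    let c : V → ℝ := fun v => if root φ v ≠ x then w x v else 0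
    have h1 : ∀ v, w x v * (i - b φ v) = c v * (i - b φ v) := by
      intro v
      by_cases hv : root φ v = x
      · simp [c, hv, b, i]
      · simp [c, hv]
    have h2 : ∀ v, w x v * (if root φ v ≠ x then q * b (insert (x, v) φ) x +
        ∑ u, w x u * (b (insert (x, v) φ) x - b (insert (x, v) φ) u) - q * i else 0) =
        c v * (q * (b φ v - i)) + ∑ u, c v * c u * (b φ v - b φ u) := by
      intro v
      by_cases hv : root φ v = x
      · simp [c, hv]
      rcases (hw x v).eq_or_lt with hz | hpos
      · simp [c, ← hz]
      have hr := hφ.root_insert hpos hx hv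
      have hbx' : b (insert (x, v) φ) x = b φ v := by
        simp only [b, hr, hxx, if_true]
      have hbu : ∀ u, w x u * (b φ v - b (insert (x, v) φ) u) = c u * (b φ v - b φ u) := by
        intro u
        simp only [b, c, hr]
        by_cases hu : root φ u = x
        · simp [hu]
        · simp [hu]
      have hcv : c v = w x v := by simp [c, hv]
      rw [if_pos hv, hbx', sum_congr rfl fun u _ => hbu u, hcv]
      simp only [mul_assoc, ← mul_sum]
      ring
    rw [hbx, sum_congr rfl fun v _ => h1 v, sum_congr rfl fun v _ => h2 v, sum_add_distrib]
    -- the summand is antisymmetric in `u` and `v`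
    have h3 : ∑ v, ∑ u, c v * c u * (b φ v - b φ u) = 0 := by
      have : ∑ v, ∑ u, c v * c u * (b φ v - b φ u) = - ∑ v, ∑ u, c v * c u * (b φ v - b φ u) := by
        conv_lhs => rw [sum_comm]
        simp only [← sum_neg_distrib]
        exact sum_congr rfl fun v _ => sum_congr rfl fun u _ => by ring
      linarith
    rw [h3, add_zero, add_sub_cancel_left, mul_sum, ← sum_add_distrib]
    exact sum_eq_zero fun v _ => by ring
  rw [forestExp_sub, forestExp_const w hq, forestExp_add, forestExp_const_mul, forestExp_sum] at h0
  simp only [forestExp_const_mul, forestExp_sub] at h0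
  have : (if x = y then q else 0) = q * i := by simp [i]
  rw [this]
  exact sub_eq_zero.1 h0

end Expectation

/-! ### The kernel of the process at an exponential time -/

section Resolvent

variable {A : Type*} [NormedRing A] [NormedAlgebra ℝ A] [CompleteSpace A]

theorem norm_exp_le_exp_norm [NormOneClass A] (a : A) :
    ‖NormedSpace.exp a‖ ≤ Real.exp ‖a‖ := by
  rw [NormedSpace.exp_eq_tsum ℝ, Real.exp_eq_exp_ℝ, NormedSpace.exp_eq_tsum ℝ]
  have h := NormedSpace.norm_expSeries_summable' (𝕂 := ℝ) a
  refine (norm_tsum_le_tsum_norm h).trans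
    (h.tsum_le_tsum (fun n => ?_) (NormedSpace.expSeries_summable' (𝕂 := ℝ) ‖a‖))
  rw [norm_smul, smul_eq_mul]
  gcongr
  · rw [Real.norm_of_nonneg (by positivity)]
  · exact norm_pow_le a n

/-- The diagonal shift by `c` makes `L` bounded by `c`, and `exp (t L) = e^{-tc} exp (t (L + c))`. -/
theorem norm_exp_smul_le_one [NormOneClass A] {L : A} {c t : ℝ} (ht : 0 ≤ t)
    (hL : ‖L + c • (1 : A)‖ ≤ c) : ‖NormedSpace.exp (t • L)‖ ≤ 1 := by
  have h1 : t • L = algebraMap ℝ A (-(t * c)) + t • (L + c • 1) := by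
    rw [Algebra.algebraMap_eq_smul_one, smul_add, smul_smul, neg_smul]; abel
  have hQ : NormedAlgebra ℚ A := NormedAlgebra.restrictScalars ℚ ℝ A
  rw [h1, NormedSpace.exp_add_of_commute (Algebra.commutes _ _),
    ← NormedSpace.algebraMap_exp_comm, ← Real.exp_eq_exp_ℝ]
  refine (norm_mul_le _ _).trans ?_
  rw [norm_algebraMap', Real.norm_of_nonneg (Real.exp_pos _).le]
  calc Real.exp (-(t * c)) * ‖NormedSpace.exp (t • (L + c • (1 : A)))‖
      ≤ Real.exp (-(t * c)) * Real.exp (t * c) := by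
        gcongr
        refine (norm_exp_le_exp_norm _).trans (Real.exp_le_exp.2 ?_)
        rw [norm_smul, Real.norm_of_nonneg ht]
        gcongr
    _ = 1 := by rw [← Real.exp_add]; simp

/-- The Laplace transform of a semigroup of contractions is the resolvent of its generator. -/
theorem integral_exp_mul_exp_smul {L M : A} {q : ℝ} (hq : 0 < q)
    (hL : ∀ t : ℝ, 0 ≤ t → ‖NormedSpace.exp (t • L)‖ ≤ 1)
    (hM : q • M - L * M = q • (1 : A)) (l : A →L[ℝ] ℝ) :
    ∫ t in Set.Ioi (0 : ℝ), q * Real.exp (-(q * t)) * l (NormedSpace.exp (t • L)) = l M := by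
  have hcont : Continuous fun t : ℝ => NormedSpace.exp (t • L) :=
    continuous_iff_continuousAt.2 fun t =>
      (hasDerivAt_exp_smul_const (𝕂 := ℝ) L t).continuousAt
  have hder : ∀ t ∈ Set.Ici (0 : ℝ),
      HasDerivAt (fun t : ℝ => -(Real.exp (-(q * t)) * l (NormedSpace.exp (t • L) * M)))
        (q * Real.exp (-(q * t)) * l (NormedSpace.exp (t • L))) t := by
    intro t _
    have h1 : HasDerivAt (fun t : ℝ => Real.exp (-(q * t))) (Real.exp (-(q * t)) * (-q)) t := by
      have := ((hasDerivAt_id t).const_mul q).neg.exp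
      simpa using this
    have h2 : HasDerivAt (fun t : ℝ => l (NormedSpace.exp (t • L) * M))
        (l (NormedSpace.exp (t • L) * L * M)) t :=
      l.hasFDerivAt.comp_hasDerivAt t ((hasDerivAt_exp_smul_const (𝕂 := ℝ) L t).mul_const M)
    have h3 : q * l (NormedSpace.exp (t • L)) =
        q * l (NormedSpace.exp (t • L) * M) - l (NormedSpace.exp (t • L) * L * M) := by
      rw [← smul_eq_mul q, ← smul_eq_mul q, ← map_smul, ← map_smul, ← map_sub]
      congr 1
      rw [mul_assoc, ← mul_smul_comm, ← mul_sub, hM, mul_smul_comm, mul_one]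
    have h4 : q * Real.exp (-(q * t)) * l (NormedSpace.exp (t • L)) =
        -(Real.exp (-(q * t)) * (-q) * l (NormedSpace.exp (t • L) * M) +
          Real.exp (-(q * t)) * l (NormedSpace.exp (t • L) * L * M)) := by
      linear_combination Real.exp (-(q * t)) * h3
    rw [h4]
    exact (h1.mul h2).neg
  have hexp : Filter.Tendsto (fun t : ℝ => Real.exp (-(q * t))) Filter.atTop (nhds 0) :=
    Real.tendsto_exp_neg_atTop_nhds_zero.comp (Filter.tendsto_id.const_mul_atTop hq)
  have hint : MeasureTheory.IntegrableOn
      (fun t : ℝ => q * Real.exp (-(q * t)) * l (NormedSpace.exp (t • L))) (Set.Ioi 0) := by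
    have h0 : MeasureTheory.IntegrableOn (fun t : ℝ => q * Real.exp (-(q * t)) * ‖l‖)
        (Set.Ioi 0) := by
      have := (exp_neg_integrableOn_Ioi 0 hq).const_mul q |>.mul_const ‖l‖
      simpa only [neg_mul, MeasureTheory.IntegrableOn] using this
    refine h0.mono' (by fun_prop) ?_
    refine (MeasureTheory.ae_restrict_iff' measurableSet_Ioi).2 (.of_forall fun t ht => ?_)
    rw [norm_mul, Real.norm_of_nonneg (by positivity)]
    gcongr
    exact (l.le_opNorm _).trans (mul_le_of_le_one_right (norm_nonneg _) (hL t (le_of_lt ht)))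
  have hlim : Filter.Tendsto
      (fun t : ℝ => -(Real.exp (-(q * t)) * l (NormedSpace.exp (t • L) * M)))
      Filter.atTop (nhds 0) := by
    have h0 := hexp.mul_const (‖l‖ * ‖M‖)
    rw [zero_mul] at h0
    refine squeeze_zero_norm' ?_ h0
    filter_upwards [Filter.eventually_ge_atTop 0] with t ht
    rw [norm_neg, norm_mul, Real.norm_of_nonneg (Real.exp_pos _).le]
    gcongr
    refine (l.le_opNorm _).trans ?_
    gcongr
    exact (norm_mul_le _ _).trans (mul_le_of_le_one_left (norm_nonneg _) (hL t ht))
  rw [MeasureTheory.integral_Ioi_of_hasDerivAt_of_tendsto' hder hint hlim]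
  simp

end Resolvent

theorem integral_expMeasure {q : ℝ} (hq : 0 < q) (f : ℝ → ℝ) :
    ∫ t, f t ∂(ProbabilityTheory.expMeasure q) =
      ∫ t in Set.Ioi (0 : ℝ), q * Real.exp (-(q * t)) * f t := by
  have h : ProbabilityTheory.expMeasure q =
      MeasureTheory.volume.withDensity (ProbabilityTheory.exponentialPDF q) := rfl
  have hm : Measurable (ProbabilityTheory.exponentialPDF q) :=
    (ProbabilityTheory.measurable_exponentialPDFReal q).ennreal_ofReal
  rw [h, integral_withDensity_eq_integral_toReal_smul hm
    (.of_forall fun _ => ENNReal.ofReal_lt_top), ← MeasureTheory.integral_Ici_eq_integral_Ioi,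
    ← MeasureTheory.integral_indicator measurableSet_Ici]
  congr 1
  ext t
  rw [ProbabilityTheory.exponentialPDF_eq]
  by_cases ht : 0 ≤ t
  · rw [Set.indicator_of_mem (Set.mem_Ici.2 ht), if_pos ht,
      ENNReal.toReal_ofReal (by positivity), smul_eq_mul]
  · rw [Set.indicator_of_notMem (by simpa using ht), if_neg ht]
    simp

section MatrixNorm

attribute [local instance] Matrix.linftyOpNormedRing Matrix.linftyOpNormedAlgebra

/-- In the norm given by the maximal row sum, `L + c` has norm at most `c` as soon as `c` is at least
every exit rate: its entries are then nonnegative and its rows have sum `c`. -/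
theorem norm_generator_add_le (w : V → V → ℝ) (hw : ∀ x y, 0 ≤ w x y) :
    ∃ c : ℝ, ‖generator w + c • (1 : Matrix V V ℝ)‖ ≤ c := by
  refine ⟨∑ x, ∑ y, w x y, ?_⟩
  set c := ∑ x, ∑ y, w x y
  have hc : 0 ≤ c := sum_nonneg fun x _ => sum_nonneg fun y _ => hw x y
  rw [Matrix.linfty_opNorm_def, ← NNReal.coe_mk c hc, NNReal.coe_le_coe]
  refine Finset.sup_le fun x _ => ?_
  rw [← NNReal.coe_le_coe]
  push_cast
  rw [← add_sum_erase univ _ (mem_univ x)]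
  have h1 : ∀ y ∈ univ.erase x, ‖(generator w + c • (1 : Matrix V V ℝ)) x y‖ = w x y := by
    intro y hy
    have hxy : x ≠ y := (ne_of_mem_erase hy).symm
    simp [generator, hxy, abs_of_nonneg (hw x y)]
  have h2 : ∑ y ∈ univ.erase x, w x y ≤ c :=
    (sum_le_sum_of_subset_of_nonneg (erase_subset _ _) fun y _ _ => hw x y).trans
      (single_le_sum (f := fun x => ∑ y, w x y)
        (fun x _ => sum_nonneg fun y _ => hw x y) (mem_univ x))
  have h3 : ‖(generator w + c • (1 : Matrix V V ℝ)) x x‖ = c - ∑ y ∈ univ.erase x, w x y := by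
    simp only [generator, Matrix.add_apply, Matrix.smul_apply, Matrix.one_apply_eq, if_true]
    rw [smul_eq_mul, mul_one, Real.norm_of_nonneg (by linarith)]
    ring
  rw [sum_congr rfl h1, h3]
  simp

/-- The matrix `K_q` is determined by the resolvent equation. -/
theorem expKernel_eq_of_resolvent [Nonempty V] (w : V → V → ℝ) (hw : ∀ x y, 0 ≤ w x y) {q : ℝ}
    (hq : 0 < q) {M : Matrix V V ℝ} (hM : q • M - generator w * M = q • (1 : Matrix V V ℝ))
    (x y : V) : expKernel w q x y = M x y := by
  have hone : NormOneClass (Matrix V V ℝ) := ⟨by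
    rw [← Matrix.diagonal_one, Matrix.linfty_opNorm_diagonal]
    exact norm_one⟩
  obtain ⟨c, hc⟩ := norm_generator_add_le w hw
  rw [expKernel, integral_expMeasure hq]
  exact integral_exp_mul_exp_smul hq (fun t ht => norm_exp_smul_le_one ht hc) hM
    (LinearMap.toContinuousLinearMap (Matrix.entryLinearMap ℝ ℝ x y))

end MatrixNorm

/-- The root in a random forest of the tree of `x` has the law of the process started from `x`
at an independent exponential time. -/
theorem expKernel_eq_rootProb [Nonempty V] {w : V → V → ℝ} (hw : ∀ x y, 0 ≤ w x y) {q : ℝ}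
    (hq : 0 < q) (x y : V) : expKernel w q x y = rootProb w q x y := by
  refine expKernel_eq_of_resolvent w hw hq (M := rootProb w q) ?_ x y
  ext a b
  have h := rootProb_resolvent hw hq a b
  have hgen : (generator w * Matrix.of (rootProb w q)) a b =
      - ∑ v, w a v * (rootProb w q a b - rootProb w q v b) := by
    rw [Matrix.mul_apply, ← add_sum_erase univ _ (mem_univ a),
      ← add_sum_erase univ (fun v => w a v * (rootProb w q a b - rootProb w q v b)) (mem_univ a)]
    have h1 : ∀ v ∈ univ.erase a, generator w a v * Matrix.of (rootProb w q) v b =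
        w a v * rootProb w q v b := by
      intro v hv
      simp [generator, (ne_of_mem_erase hv).symm]
    rw [sum_congr rfl h1]
    simp only [generator, if_true, Matrix.of_apply, sub_self, mul_zero, zero_add, mul_sub,
      sum_sub_distrib, ← sum_mul]
    ring
  simp only [Matrix.sub_apply, Matrix.smul_apply, Matrix.one_apply, smul_eq_mul]
  change q * rootProb w q a b - (generator w * Matrix.of (rootProb w q)) a b = _
  rw [hgen, sub_neg_eq_add, h]
  simp

/-! ### The error of a fixed forest -/

section Error

variable {w : V → V → ℝ} {μ : V → ℝ} {q : ℝ}

theorem IsProbVector.pos_of_irreducible (hμ : IsProbVector μ) (hirr : IsIrreducible w)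
    (hrev : IsReversible w μ) (x : V) : 0 < μ x := by
  obtain ⟨a, ha⟩ : ∃ a, 0 < μ a := by
    by_contra! h
    have h1 : ∑ x, μ x ≤ 0 := sum_nonpos fun x _ => h x
    rw [hμ.2] at h1
    linarith
  induction hirr a x with
  | refl => exact ha
  | @tail b c _ hbc ih =>
    refine (hμ.1 c).lt_of_ne fun h0 => ?_
    have h1 := hrev b c
    rw [← h0, zero_mul] at h1
    exact (mul_pos ih hbc).ne' h1

theorem IsSpanningForest.treeBlock_congr {φ : Finset (V × V)} (hφ : IsSpanningForest w φ)
    {x y : V} (h : root φ x = root φ y) : treeBlock φ x = treeBlock φ y := by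
  ext z
  rw [hφ.mem_treeBlock, hφ.mem_treeBlock, h]

theorem sum_roots_treeBlock {φ : Finset (V × V)} (hφ : IsSpanningForest w φ) (f : V → ℝ) :
    ∑ r : roots φ, ∑ z ∈ treeBlock φ r, f z = ∑ z, f z := by
  rw [sum_coe_sort (roots φ) (fun r => ∑ z ∈ treeBlock φ r, f z),
    ← sum_fiberwise_of_maps_to (fun z _ => hφ.root_mem z) f]
  refine sum_congr rfl fun r hr => sum_congr ?_ fun _ _ => rfl
  ext z
  rw [hφ.mem_treeBlock, hφ.root_eq_self_iff.2 hr]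
  simp

variable {φ : Finset (V × V)}

theorem sum_treeBlock_pos (hμ : ∀ x, 0 < μ x) (hφ : IsSpanningForest w φ) (x : V) :
    0 < ∑ z ∈ treeBlock φ x, μ z :=
  sum_pos (fun z _ => hμ z) ⟨x, hφ.mem_treeBlock.2 rfl⟩

theorem condOn_nonneg (hμ : ∀ x, 0 < μ x) (A : Finset V) (z : V) : 0 ≤ condOn μ A z := by
  unfold condOn
  split_ifs
  · exact div_nonneg (hμ z).le (sum_nonneg fun x _ => (hμ x).le)
  · rfl

theorem sum_condOn (hμ : ∀ x, 0 < μ x) (hφ : IsSpanningForest w φ) (y : V) :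
    ∑ z, condOn μ (treeBlock φ y) z = 1 := by
  unfold condOn
  rw [sum_ite_mem, univ_inter, ← sum_div]
  exact div_self (sum_treeBlock_pos hμ hφ y).ne'

theorem condOn_le_one (hμ : ∀ x, 0 < μ x) (hφ : IsSpanningForest w φ) (y z : V) :
    condOn μ (treeBlock φ y) z ≤ 1 := by
  rw [← sum_condOn hμ hφ y]
  exact single_le_sum (f := condOn μ (treeBlock φ y)) (fun x _ => condOn_nonneg hμ _ x)
    (mem_univ z)

theorem condOn_treeBlock_of_ne (hφ : IsSpanningForest w φ) {y z : V} (h : root φ z ≠ root φ y) :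
    condOn μ (treeBlock φ y) z = 0 :=
  if_neg fun hz => h (hφ.mem_treeBlock.1 hz)

variable [Nonempty V]

/-- The matrix `Λ K_q` in terms of the probabilities of the roots. -/
theorem forestLambda_mul_apply (hw : ∀ x y, 0 ≤ w x y) (hq : 0 < q) (r : roots φ) (y : V) :
    (forestLambda μ φ * expKernel w q) r y =
      ∑ x, condOn μ (treeBlock φ r) x * rootProb w q x y := by
  rw [Matrix.mul_apply]
  exact sum_congr rfl fun x _ => by rw [expKernel_eq_rootProb hw hq]; rfl

/-- To follow `P̄ Λ` is to move to the root of a random forest and to resample the position in the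
block reached. -/
theorem forestPbar_mul_apply (hw : ∀ x y, 0 ≤ w x y) (hq : 0 < q) (hφ : IsSpanningForest w φ)
    (r : roots φ) (y : V) :
    (forestPbar w μ q φ * forestLambda μ φ) r y =
      ∑ x, condOn μ (treeBlock φ r) x *
        ∑ z, condOn μ (treeBlock φ z) y * rootProb w q x z := by
  rw [Matrix.mul_apply]
  simp only [forestPbar, forestLambda, probExpTime, sum_mul, expKernel_eq_rootProb hw hq]
  rw [sum_comm]
  refine sum_congr rfl fun x _ => ?_
  rw [← sum_roots_treeBlock hφ (fun z => condOn μ (treeBlock φ z) y * rootProb w q x z), mul_sum]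
  refine sum_congr rfl fun s _ => ?_
  rw [mul_assoc, sum_mul]
  congr 1
  refine sum_congr rfl fun z hz => ?_
  rw [hφ.treeBlock_congr (hφ.mem_treeBlock.1 hz), mul_comm]

/-- Each of the total variation distances is at most one. -/
theorem intertwiningError_le_card (hw : ∀ x y, 0 ≤ w x y) (hq : 0 < q) (hμ : ∀ x, 0 < μ x)
    (hφ : IsSpanningForest w φ) : intertwiningError w μ q φ ≤ (roots φ).card := by
  unfold intertwiningError
  have h : ∀ r : roots φ, dTV ((forestLambda μ φ * expKernel w q) r)
      ((forestPbar w μ q φ * forestLambda μ φ) r) ≤ 1 := by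
    intro r
    unfold dTV
    have h1 : ∑ y, (forestLambda μ φ * expKernel w q) r y = 1 := by
      simp only [forestLambda_mul_apply hw hq]
      rw [sum_comm]
      simp only [← mul_sum, sum_rootProb w hq, mul_one]
      exact sum_condOn hμ hφ r
    have h2 : ∑ y, (forestPbar w μ q φ * forestLambda μ φ) r y = 1 := by
      simp only [forestPbar_mul_apply hw hq hφ]
      rw [sum_comm]
      have : ∀ x, ∑ y, condOn μ (treeBlock φ r) x *
          ∑ z, condOn μ (treeBlock φ z) y * rootProb w q x z = condOn μ (treeBlock φ r) x := by
        intro x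
        rw [← mul_sum, sum_comm]
        simp only [← sum_mul, sum_condOn hμ hφ, one_mul, sum_rootProb w hq, mul_one]
      simp only [this]
      exact sum_condOn hμ hφ r
    have h3 : ∀ y, |(forestLambda μ φ * expKernel w q) r y -
        (forestPbar w μ q φ * forestLambda μ φ) r y| ≤
        (forestLambda μ φ * expKernel w q) r y +
        (forestPbar w μ q φ * forestLambda μ φ) r y := by
      intro y
      have ha : 0 ≤ (forestLambda μ φ * expKernel w q) r y := by
        rw [forestLambda_mul_apply hw hq]
        exact sum_nonneg fun x _ => mul_nonneg (condOn_nonneg hμ _ _) (rootProb_nonneg hq _ _)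
      have hb : 0 ≤ (forestPbar w μ q φ * forestLambda μ φ) r y := by
        rw [forestPbar_mul_apply hw hq hφ]
        exact sum_nonneg fun x _ => mul_nonneg (condOn_nonneg hμ _ _)
          (sum_nonneg fun z _ => mul_nonneg (condOn_nonneg hμ _ _) (rootProb_nonneg hq _ _))
      rw [abs_le]
      constructor <;> linarith
    have h4 := sum_le_sum fun y (_ : y ∈ univ) => h3 y
    rw [sum_add_distrib, h1, h2] at h4
    linarith
  refine (sum_le_sum fun r _ => h r).trans ?_
  simp

/-- The probability that `y` is the root of the tree of `x` and that `z` is in another tree. -/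
def splitProb (w : V → V → ℝ) (q : ℝ) (x y z : V) : ℝ :=
  forestExp w q fun φ => if root φ x = y ∧ root φ z ≠ y then 1 else 0

theorem splitProb_nonneg (hq : 0 < q) (x y z : V) : 0 ≤ splitProb w q x y z :=
  forestExp_nonneg hq fun φ _ => by split_ifs <;> simp

/-- The forests in which `y` and `z` are in the same tree cancel out, by moving the root of this
tree from `y` to `z`. -/
theorem mul_rootProb_sub (hq : 0 < q) (hμ : ∀ x, 0 < μ x) (hrev : IsReversible w μ) (x y z : V) :
    μ z * rootProb w q x y - μ y * rootProb w q x z =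
      μ z * splitProb w q x y z - μ y * splitProb w q x z y := by
  have h := forestExp_reroot hq hμ hrev y z (fun φ => if root φ x = root φ z then 1 else 0)
    (fun φ φ' _ _ h => by simp only [h])
  have h1 : forestExp w q (fun φ => if root φ z = y then if root φ x = root φ z then 1 else 0
      else 0) = rootProb w q x y - splitProb w q x y z := by
    rw [rootProb, splitProb, ← forestExp_sub]
    refine forestExp_congr fun φ _ => ?_
    by_cases h1 : root φ x = y <;> by_cases h2 : root φ z = y <;> simp [h1, h2]
  have h2 : forestExp w q (fun φ => if root φ y = z then if root φ x = root φ z then 1 else 0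
      else 0) = rootProb w q x z - splitProb w q x z y := by
    rw [rootProb, splitProb, ← forestExp_sub]
    refine forestExp_congr fun φ hφ => ?_
    by_cases h2 : root φ y = z
    · have h3 : root φ z = z := h2 ▸ hφ.root_root y
      by_cases h1 : root φ x = z <;> simp [h1, h2, h3]
    · by_cases h1 : root φ x = z <;> simp [h1, h2]
  rw [h1, h2] at h
  linear_combination h

/-- The error of a fixed forest. The factor `1 / 2` of the total variation distance is compensated by
the two terms of `mul_rootProb_sub`, which have the same sum over `y` and `z`. -/
theorem intertwiningError_le_sum_splitProb (hw : ∀ x y, 0 ≤ w x y) (hq : 0 < q)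
    (hμ : ∀ x, 0 < μ x) (hrev : IsReversible w μ) (hφ : IsSpanningForest w φ) :
    intertwiningError w μ q φ ≤
      ∑ x, ∑ y, ∑ z, condOn μ (treeBlock φ y) z * splitProb w q x y z := by
  set W : V → V → ℝ := fun y z => condOn μ (treeBlock φ y) z with hW
  have hW0 : ∀ y z, 0 ≤ W y z := fun y z => condOn_nonneg hμ _ _
  have hterm : ∀ x y z, |W y z * rootProb w q x y - W z y * rootProb w q x z| ≤
      W y z * splitProb w q x y z + W z y * splitProb w q x z y := by
    intro x y z
    have heq : W y z * rootProb w q x y - W z y * rootProb w q x z =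
        W y z * splitProb w q x y z - W z y * splitProb w q x z y := by
      by_cases h : root φ z = root φ y
      · simp only [hW, condOn, hφ.treeBlock_congr h, hφ.mem_treeBlock, h, if_true]
        have := mul_rootProb_sub hq hμ hrev x y z
        linear_combination (∑ z ∈ treeBlock φ y, μ z)⁻¹ * this
      · simp only [hW, condOn_treeBlock_of_ne hφ h, condOn_treeBlock_of_ne hφ (Ne.symm h)]
        ring
    have h1 := mul_nonneg (hW0 y z) (splitProb_nonneg (w := w) hq x y z)
    have h2 := mul_nonneg (hW0 z y) (splitProb_nonneg (w := w) hq x z y)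
    rw [heq, abs_le]
    constructor <;> linarith
  set S : V → ℝ := fun x => ∑ y, ∑ z, W y z * splitProb w q x y z with hS
  have hS0 : ∀ x, 0 ≤ S x := fun x => sum_nonneg fun y _ => sum_nonneg fun z _ =>
    mul_nonneg (hW0 y z) (splitProb_nonneg hq x y z)
  have hrow : ∀ r : roots φ, dTV ((forestLambda μ φ * expKernel w q) r)
      ((forestPbar w μ q φ * forestLambda μ φ) r) ≤ ∑ x, W r x * S x := by
    intro r
    have habs : ∀ y, |(forestLambda μ φ * expKernel w q) r y -
        (forestPbar w μ q φ * forestLambda μ φ) r y| ≤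
        ∑ x, W r x * ∑ z, (W y z * splitProb w q x y z + W z y * splitProb w q x z y) := by
      intro y
      rw [forestLambda_mul_apply hw hq, forestPbar_mul_apply hw hq hφ, ← sum_sub_distrib]
      refine (abs_sum_le_sum_abs _ _).trans (sum_le_sum fun x _ => ?_)
      rw [← mul_sub, abs_mul, abs_of_nonneg (condOn_nonneg hμ _ _)]
      refine mul_le_mul_of_nonneg_left ?_ (hW0 r x)
      have h1 : rootProb w q x y = ∑ z, W y z * rootProb w q x y := by
        rw [← sum_mul, sum_condOn hμ hφ, one_mul]
      rw [h1, ← sum_sub_distrib]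
      exact (abs_sum_le_sum_abs _ _).trans (sum_le_sum fun z _ => hterm x y z)
    unfold dTV
    calc 1 / 2 * ∑ y, |(forestLambda μ φ * expKernel w q) r y -
          (forestPbar w μ q φ * forestLambda μ φ) r y|
        ≤ 1 / 2 * ∑ y, ∑ x, W r x *
            ∑ z, (W y z * splitProb w q x y z + W z y * splitProb w q x z y) := by
          gcongr with y _
          exact habs y
      _ = 1 / 2 * ∑ x, W r x * (S x + S x) := by
          rw [sum_comm]
          congr 1
          refine sum_congr rfl fun x _ => ?_
          rw [← mul_sum]
          congr 1
          simp only [sum_add_distrib]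
          congr 1
          exact sum_comm
      _ = ∑ x, W r x * S x := by
          rw [mul_sum]
          exact sum_congr rfl fun x _ => by ring
  calc intertwiningError w μ q φ ≤ ∑ r : roots φ, ∑ x, W r x * S x :=
        sum_le_sum fun r _ => hrow r
    _ = ∑ x, W (root φ x) x * S x := by
        rw [sum_comm]
        refine sum_congr rfl fun x _ => ?_
        refine sum_eq_single (⟨root φ x, hφ.root_mem x⟩ : roots φ) ?_ (by simp)
        intro r _ hr
        rw [hW]
        simp only
        rw [condOn_treeBlock_of_ne hφ, zero_mul]
        rw [hφ.root_eq_self_iff.2 r.2]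
        exact fun h => hr (Subtype.ext h.symm)
    _ ≤ ∑ x, S x := sum_le_sum fun x _ =>
        mul_le_of_le_one_left (hS0 x) (condOn_le_one hμ hφ _ _)

end Error

/-! ### Averaging over the forest -/

section Average

variable {w : V → V → ℝ} {μ : V → ℝ} {q q' : ℝ}

/-- Given the trees, the root of the tree of `y` has law `μ` conditioned on this tree. -/
theorem forestExp_condOn (hq : 0 < q) (hμ : ∀ x, 0 < μ x) (hrev : IsReversible w μ) (y z : V) :
    forestExp w q (fun φ => condOn μ (treeBlock φ y) z) = rootProb w q y z := by
  let g : Finset (V × V) → ℝ := fun φ =>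
    if root φ y = root φ z then (∑ x ∈ treeBlock φ y, μ x)⁻¹ else 0
  have hg : ∀ φ φ', IsSpanningForest w φ → IsSpanningForest w φ' →
      (∀ a b, root φ' a = root φ' b ↔ root φ a = root φ b) → g φ' = g φ := by
    intro φ φ' hφ hφ' h
    have : treeBlock φ' y = treeBlock φ y := by
      ext a
      rw [hφ.mem_treeBlock, hφ'.mem_treeBlock, h]
    simp only [g, h, this]
  have h := sum_congr rfl fun r (_ : r ∈ univ) => forestExp_reroot hq hμ hrev r z g hg
  simp only [← forestExp_const_mul, ← forestExp_sum] at h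
  refine (forestExp_congr fun φ hφ => ?_).trans (h.trans (forestExp_congr fun φ hφ => ?_))
  · rw [← mul_sum, sum_ite_eq, if_pos (mem_univ _)]
    simp only [g, condOn, hφ.mem_treeBlock, eq_comm (a := root φ z)]
    split_ifs <;> simp [div_eq_mul_inv]
  · by_cases hy : root φ y = z
    · have hz : root φ z = z := hy ▸ hφ.root_root y
      have hgφ : g φ = (∑ x ∈ treeBlock φ y, μ x)⁻¹ := by simp only [g, hy, hz, if_true]
      have hsum : ∑ r, μ r * (if root φ r = z then g φ else 0) =
          (∑ r ∈ treeBlock φ y, μ r) * g φ := by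
        have : treeBlock φ y = univ.filter fun r => root φ r = z := by
          ext r
          simp [hφ.mem_treeBlock, hy]
        rw [this, sum_mul, sum_filter]
        exact sum_congr rfl fun r _ => by rw [mul_ite, mul_zero]
      rw [if_pos hy, hsum, hgφ]
      exact mul_inv_cancel₀ (sum_treeBlock_pos hμ hφ y).ne'
    · rw [if_neg hy]
      refine sum_eq_zero fun r _ => ?_
      by_cases hr : root φ r = z
      · have hz : root φ z = z := hr ▸ hφ.root_root r
        simp [g, hz, hy]
      · simp [hr]

theorem mul_rootProb_comm (hq : 0 < q) (hμ : ∀ x, 0 < μ x) (hrev : IsReversible w μ) (x y : V) :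
    μ x * rootProb w q x y = μ y * rootProb w q y x :=
  forestExp_reroot hq hμ hrev y x (fun _ => 1) fun _ _ _ _ _ => rfl

open Classical in
/-- The exchange of an edge `(u, v)` between two forests. The edge is on the path from `y` to its
root in the first forest, and it leaves the tree with root `y` of the second one. In the first
forest the edge is removed and the root of the tree of `u` is moved back from `u` to `y`; in the
second one the root is moved from `y` to `u` and the edge is added. The factors `μ u / μ y` and
`w u v` cancel out, and one root is transferred from the second forest to the first. -/
theorem forestExp_edge_mul_le (hw : ∀ x y, 0 ≤ w x y) (hq : 0 < q) (hq' : 0 < q')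
    (hμ : ∀ x, 0 < μ x) (hrev : IsReversible w μ) (x y u v : V) :
    forestExp w q (fun φ => if (u, v) ∈ φ then if LeadsTo φ y u then 1 else 0 else 0) *
      forestExp w q' (fun φ' => if root φ' u = y then
        if root φ' x = root φ' u ∧ root φ' v ≠ root φ' u then 1 else 0 else 0) ≤
    q' / q * (rootProb w q u y *
      forestExp w q' (fun φ' => if (u, v) ∈ rootPath φ' x then 1 else 0)) := by
  set a := forestExp w q (fun φ => if (u, v) ∈ φ then if LeadsTo φ y u then 1 else 0 else 0)
  set b := forestExp w q' (fun φ' => if root φ' u = y then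
        if root φ' x = root φ' u ∧ root φ' v ≠ root φ' u then 1 else 0 else 0) with hb
  set c := forestExp w q' (fun φ' => if (u, v) ∈ rootPath φ' x then 1 else 0) with hc
  have hb0 : 0 ≤ b := forestExp_nonneg hq' fun φ _ => by split_ifs <;> simp
  have ha : q * a ≤ w u v * rootProb w q y u := by
    rw [forestExp_edge hw]
    refine mul_le_mul_of_nonneg_left (forestExp_mono hq fun φ hφ => ?_) (hw u v)
    by_cases h : u ∈ roots φ ∧ root φ v ≠ u
    · rw [if_pos h]
      simp only [hφ.leadsTo_insert_iff h.1]
      rfl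
    · rw [if_neg h]
      split_ifs <;> simp
  have ha' : μ y * (q * a) ≤ w u v * (μ u * rootProb w q u y) := by
    rw [← mul_rootProb_comm hq hμ hrev y u]
    nlinarith [hμ y]
  have hbc : μ u * (w u v * b) ≤ μ y * (q' * c) := by
    have h1 := forestExp_reroot hq' hμ hrev y u
      (fun φ' => if root φ' x = root φ' u ∧ root φ' v ≠ root φ' u then 1 else 0)
      (fun φ φ' _ _ h => by simp only [ne_eq, h])
    rw [← hb] at h1
    have h2 : w u v * forestExp w q' (fun φ' => if root φ' y = u then
        if root φ' x = root φ' u ∧ root φ' v ≠ root φ' u then 1 else 0 else 0) ≤ q' * c := by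
      have h3 : c = forestExp w q' (fun φ' => if (u, v) ∈ φ' then
          if LeadsTo φ' x u then 1 else 0 else 0) := by
        refine forestExp_congr fun φ _ => ?_
        simp only [rootPath, mem_filter]
        by_cases h : (u, v) ∈ φ <;> simp [h]
      rw [h3, forestExp_edge hw]
      refine mul_le_mul_of_nonneg_left (forestExp_mono hq' fun φ hφ => ?_) (hw u v)
      by_cases hy : root φ y = u
      · have hu : root φ u = u := hy ▸ hφ.root_root y
        have hur := hφ.root_eq_self_iff.1 hu
        simp only [hφ.leadsTo_insert_iff hur, hy, hu, hur, if_true, true_and]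
        by_cases hx : root φ x = u <;> by_cases hv : root φ v = u <;> simp [hx, hv]
      · rw [if_neg hy]
        split_ifs <;> simp
    calc μ u * (w u v * b) = w u v * (μ u * b) := by ring
      _ = μ y * (w u v * forestExp w q' (fun φ' => if root φ' y = u then
        if root φ' x = root φ' u ∧ root φ' v ≠ root φ' u then 1 else 0 else 0)) := by
          rw [h1]; ring
      _ ≤ μ y * (q' * c) := mul_le_mul_of_nonneg_left h2 (hμ y).le
  have hP : 0 ≤ rootProb w q u y := rootProb_nonneg hq u y
  have key : μ y * q * (a * b) ≤ μ y * q * (q' / q * (rootProb w q u y * c)) := by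
    calc μ y * q * (a * b) = (μ y * (q * a)) * b := by ring
      _ ≤ (w u v * (μ u * rootProb w q u y)) * b := mul_le_mul_of_nonneg_right ha' hb0
      _ = (μ u * (w u v * b)) * rootProb w q u y := by ring
      _ ≤ (μ y * (q' * c)) * rootProb w q u y := mul_le_mul_of_nonneg_right hbc hP
      _ = μ y * q * (q' / q * (rootProb w q u y * c)) := by field_simp
  exact le_of_mul_le_mul_left key (mul_pos (hμ y) hq)

open Classical in
/-- If `y` is the root of `x` in `Φ'` and the root of `y` in `Φ` is in another tree of `Φ'`, then
an edge of the path of `Φ` from `y` leaves the tree of `y` in `Φ'`. -/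
theorem splitProb_root_le (hq' : 0 < q') {φ : Finset (V × V)} (hφ : IsSpanningForest w φ)
    (x y : V) : splitProb w q' x y (root φ y) ≤
      ∑ u, ∑ v, (if (u, v) ∈ φ then if LeadsTo φ y u then 1 else 0 else 0) *
        forestExp w q' (fun φ' => if root φ' u = y then
          if root φ' x = root φ' u ∧ root φ' v ≠ root φ' u then 1 else 0 else 0) := by
  simp only [← forestExp_const_mul, ← forestExp_sum]
  refine forestExp_mono hq' fun φ' hφ' => ?_
  have hterm : ∀ u v, (0 : ℝ) ≤ (if (u, v) ∈ φ then if LeadsTo φ y u then 1 else 0 else 0) *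
      (if root φ' u = y then
        if root φ' x = root φ' u ∧ root φ' v ≠ root φ' u then 1 else 0 else 0) := by
    intro u v
    split_ifs <;> simp
  split_ifs with h
  · obtain ⟨hx, hz⟩ := h
    have hy : root φ' y = y := hx ▸ hφ'.root_root x
    obtain ⟨u, v, huv, hyu, hu, hv⟩ := hφ.exists_exit_edge (fun a => root φ' a = y) hy hz
    refine le_trans ?_ (single_le_sum (fun u _ => sum_nonneg fun v _ => hterm u v) (mem_univ u))
    refine le_trans ?_ (single_le_sum (fun v _ => hterm u v) (mem_univ v))
    simp [huv, hyu, hu, hx, hv]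
  · exact sum_nonneg fun u _ => sum_nonneg fun v _ => hterm u v

/-- The sum of `forestExp_edge_mul_le` over `y` and over the edges `(u, v)`, for a fixed `x`. -/
theorem sum_rootProb_mul_splitProb_le (hw : ∀ x y, 0 ≤ w x y) (hq : 0 < q) (hq' : 0 < q')
    (hμ : ∀ x, 0 < μ x) (hrev : IsReversible w μ) (x : V) :
    ∑ y, ∑ z, rootProb w q y z * splitProb w q' x y z ≤
      q' / q * forestExp w q' (fun φ' => ((rootPath φ' x).card : ℝ)) := by
  classical
  let a : V → V → V → ℝ := fun y u v =>
    forestExp w q (fun φ => if (u, v) ∈ φ then if LeadsTo φ y u then 1 else 0 else 0)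
  let b : V → V → V → ℝ := fun y u v => forestExp w q' (fun φ' => if root φ' u = y then
    if root φ' x = root φ' u ∧ root φ' v ≠ root φ' u then 1 else 0 else 0)
  let c : V → V → ℝ := fun u v =>
    forestExp w q' (fun φ' => if (u, v) ∈ rootPath φ' x then 1 else 0)
  have h1 : ∀ y, ∑ z, rootProb w q y z * splitProb w q' x y z ≤ ∑ u, ∑ v, a y u v * b y u v := by
    intro y
    calc ∑ z, rootProb w q y z * splitProb w q' x y z
        = forestExp w q (fun φ => splitProb w q' x y (root φ y)) := by
          simp only [rootProb, ← forestExp_mul_const, ← forestExp_sum]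
          exact forestExp_congr fun φ _ => by simp
      _ ≤ forestExp w q (fun φ => ∑ u, ∑ v,
          (if (u, v) ∈ φ then if LeadsTo φ y u then 1 else 0 else 0) * b y u v) :=
          forestExp_mono hq fun φ hφ => splitProb_root_le hq' hφ x y
      _ = ∑ u, ∑ v, a y u v * b y u v := by
          simp only [forestExp_sum, forestExp_mul_const, a]
  have h2 : ∑ u, ∑ v, c u v = forestExp w q' (fun φ' => ((rootPath φ' x).card : ℝ)) := by
    simp only [c, ← forestExp_sum]
    refine forestExp_congr fun φ _ => ?_
    rw [← Fintype.sum_prod_type' (fun u v => if (u, v) ∈ rootPath φ x then (1 : ℝ) else 0)]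
    simp
  calc ∑ y, ∑ z, rootProb w q y z * splitProb w q' x y z
      ≤ ∑ y, ∑ u, ∑ v, q' / q * (rootProb w q u y * c u v) := by
        refine sum_le_sum fun y _ => (h1 y).trans ?_
        exact sum_le_sum fun u _ => sum_le_sum fun v _ =>
          forestExp_edge_mul_le hw hq hq' hμ hrev x y u v
    _ = ∑ u, ∑ v, q' / q * ((∑ y, rootProb w q u y) * c u v) := by
        rw [sum_comm]
        refine sum_congr rfl fun u _ => ?_
        rw [sum_comm]
        exact sum_congr rfl fun v _ => by rw [← mul_sum, sum_mul]
    _ = q' / q * forestExp w q' (fun φ' => ((rootPath φ' x).card : ℝ)) := by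
        simp only [sum_rootProb w hq, one_mul, ← mul_sum, h2]

theorem forestExp_intertwiningError_le [Nonempty V] (hw : ∀ x y, 0 ≤ w x y) (hq : 0 < q)
    (hq' : 0 < q') (hμ : ∀ x, 0 < μ x) (hrev : IsReversible w μ) :
    forestExp w q (fun φ => intertwiningError w μ q' φ) ≤
      q' / q * ∑ x, forestExp w q' (fun φ' => ((rootPath φ' x).card : ℝ)) := by
  calc forestExp w q (fun φ => intertwiningError w μ q' φ)
      ≤ forestExp w q (fun φ =>
          ∑ x, ∑ y, ∑ z, condOn μ (treeBlock φ y) z * splitProb w q' x y z) :=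
        forestExp_mono hq fun φ hφ => intertwiningError_le_sum_splitProb hw hq' hμ hrev hφ
    _ = ∑ x, ∑ y, ∑ z, rootProb w q y z * splitProb w q' x y z := by
        simp only [forestExp_sum, forestExp_mul_const, forestExp_condOn hq hμ hrev]
    _ ≤ ∑ x, q' / q * forestExp w q' (fun φ' => ((rootPath φ' x).card : ℝ)) :=
        sum_le_sum fun x _ => sum_rootProb_mul_splitProb_le hw hq hq' hμ hrev x
    _ = q' / q * ∑ x, forestExp w q' (fun φ' => ((rootPath φ' x).card : ℝ)) := by
        rw [mul_sum]

end Average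

/-! ### Interpolation between the two bounds -/

theorem le_rpow_mul_rpow_of_le {e a b s t : ℝ} (he : 0 ≤ e) (hea : e ≤ a) (heb : e ≤ b)
    (hs : 0 ≤ s) (ht : 0 ≤ t) (hst : s + t = 1) : e ≤ a ^ s * b ^ t :=
  calc e = e ^ s * e ^ t := by rw [← Real.rpow_add_of_nonneg he hs ht, hst, Real.rpow_one]
    _ ≤ a ^ s * b ^ t :=
      mul_le_mul (Real.rpow_le_rpow he hea hs) (Real.rpow_le_rpow he heb ht)
        (Real.rpow_nonneg he t) (Real.rpow_nonneg (he.trans hea) s)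

end

end ForestIntertwining

theorem mainTheorem2 {V : Type*} [Fintype V] [DecidableEq V]
    (w : V → V → ℝ) (μ : V → ℝ)
    (hw : ∀ x y, 0 ≤ w x y)
    (hirr : ForestIntertwining.IsIrreducible w)
    (hμ : ForestIntertwining.IsProbVector μ)
    (hrev : ForestIntertwining.IsReversible w μ)
    (q q' : ℝ) (hq : 0 < q) (hq' : 0 < q')
    (p pstar : ENNReal) (hp : 1 ≤ p) (hconj : 1 / p + 1 / pstar = 1) :
    ForestIntertwining.forestExp w q
        (fun φ => ForestIntertwining.intertwiningError w μ q' φ) ≤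
      (ForestIntertwining.forestExp w q
          (fun φ => ((ForestIntertwining.roots φ).card : ℝ))) ^ (1 / p).toReal *
        ((q' / q) * ∑ x : V, ForestIntertwining.forestExp w q'
          (fun φ' => ((ForestIntertwining.rootPath φ' x).card : ℝ))) ^ (1 / pstar).toReal := by
  have hne : Nonempty V := by
    by_contra h
    rw [not_nonempty_iff] at h
    simpa using hμ.2
  have hpos : ∀ x, 0 < μ x := hμ.pos_of_irreducible hirr hrev
  have hsum : (1 / p).toReal + (1 / pstar).toReal = 1 := by
    have h1 : 1 / p ≠ ⊤ := fun h => by simp [h] at hconj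
    have h2 : 1 / pstar ≠ ⊤ := fun h => by simp [h] at hconj
    rw [← ENNReal.toReal_add h1 h2, hconj, ENNReal.toReal_one]
  refine ForestIntertwining.le_rpow_mul_rpow_of_le ?_ ?_ ?_ ENNReal.toReal_nonneg
    ENNReal.toReal_nonneg hsum
  · refine ForestIntertwining.forestExp_nonneg hq fun φ _ => sum_nonneg fun r _ => ?_
    exact mul_nonneg (by norm_num) (sum_nonneg fun x _ => abs_nonneg _)
  · exact ForestIntertwining.forestExp_mono hq fun φ hφ =>
      ForestIntertwining.intertwiningError_le_card hw hq' hpos hφ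
  · exact ForestIntertwining.forestExp_intertwiningError_le hw hq hq' hpos hrev
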